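/- Let $d\ge 1$ be an integer and let $0<s<1$ with $d>2s$. Let $k\ge 0$ be an integer, $a\in\mathbb R^d$ and $r>0$; write $B_\rho(a)$ for the open Euclidean ball of radius $\rho$ centred at $a$. Let $C^k(\overline{B_r(a)})$ be the space of functions $\varphi: B_r(a)\to\mathbb R$ of class $C^k$ all of whose partial derivatives $D^\alpha\varphi$, $|\alpha|\le k$, are uniformly continuous on $B_r(a)$, with the norm $$\|\varphi\|_{C^k(\overline{B_r(a)})}=\sum_{|\alpha|\le k}\ \sup_{x\in B_r(a)}|D^\alpha\varphi(x)| .$$ For $h\in C_c^\infty(\mathbb R^d)$ put $$K_{2s-d}h(x)=\int_{\mathbb R^d}|x-y|^{2s-d}\,h(y)\,dy,\qquad x\in\mathbb R^d .$$ Then for every $u\in C^k(\overline{B_r(a)})$ and every $\varepsilon>0$ there is a real-valued $h\in C_c^\infty\big(B_{4r}(a)\setminus\overline{B_{3r}(a)}\big)$ such that $K_{2s-d}h$, restricted to $B_r(a)$, belongs to $C^k(\overline{B_r(a)})$ and $$\|u-K_{2s-d}h\|_{C^k(\overline{B_r(a)})}<\varepsilon .$$ -/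

import Mathlib

open MeasureTheory Metric
open scoped ENNReal ContDiff

noncomputable section

namespace RieszApprox

/-- The partial derivative `∂φ/∂xᵢ` of a function on `ℝ^d`. -/
def partialDeriv {d : ℕ} (i : Fin d) (φ : EuclideanSpace ℝ (Fin d) → ℝ) :
    EuclideanSpace ℝ (Fin d) → ℝ :=
  fun x => lineDeriv ℝ φ x (EuclideanSpace.single i 1)

/-- The derivative `D^α φ = ∂₁^{α₁} ⋯ ∂_d^{α_d} φ` for a multi-index `α`. At the points of an open
set `U` it depends only on the restriction of `φ` to `U`. -/
def multiDeriv {d : ℕ} (α : Fin d → ℕ) (φ : EuclideanSpace ℝ (Fin d) → ℝ) :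
    EuclideanSpace ℝ (Fin d) → ℝ :=
  (List.finRange d).foldr (fun i ψ => (partialDeriv i)^[α i] ψ) φ

/-- The finite set of multi-indices `α ∈ ℕ^d` with `|α| ≤ k`. -/
def multiIndices (d k : ℕ) : Finset (Fin d → ℕ) :=
  (Fintype.piFinset fun _ : Fin d => Finset.range (k + 1)).filter fun α => ∑ i, α i ≤ k

theorem mem_multiIndices {d k : ℕ} {α : Fin d → ℕ} :
    α ∈ multiIndices d k ↔ ∑ i, α i ≤ k := by
  simp only [multiIndices, Finset.mem_filter, Fintype.mem_piFinset, Finset.mem_range,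
    and_iff_right_iff_imp]
  intro h i
  exact Nat.lt_succ_of_le
    ((Finset.single_le_sum (fun j _ => Nat.zero_le (α j)) (Finset.mem_univ i)).trans h)

/-- For `U` open, `φ|_U` belongs to `C^k(closure U)`: it is of class `C^k` on `U`, and all its
derivatives of order at most `k` are uniformly continuous on bounded subsets of `U`. Functions on
`U` are represented by functions on `ℝ^d` whose values outside `U` play no role. -/
def MemCk {d : ℕ} (k : ℕ) (U : Set (EuclideanSpace ℝ (Fin d)))
    (φ : EuclideanSpace ℝ (Fin d) → ℝ) : Prop :=
  ContDiffOn ℝ k φ U ∧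
    ∀ α ∈ multiIndices d k, ∀ B ⊆ U, Bornology.IsBounded B →
      UniformContinuousOn (multiDeriv α φ) B

/-- The norm `‖φ‖_{C^k(closure U)} = ∑_{|α| ≤ k} sup_{x ∈ U} |D^α φ(x)|`, with values in
`[0, ∞]`. -/
def ckNorm {d : ℕ} (k : ℕ) (U : Set (EuclideanSpace ℝ (Fin d)))
    (φ : EuclideanSpace ℝ (Fin d) → ℝ) : ℝ≥0∞ :=
  ∑ α ∈ multiIndices d k, ⨆ x ∈ U, ‖multiDeriv α φ x‖ₑ

/-- `h ∈ C_c^∞(V)`: a smooth function on `ℝ^d` whose support is a compact subset of `V`. -/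
def IsTestFunction {d : ℕ} (V : Set (EuclideanSpace ℝ (Fin d)))
    (h : EuclideanSpace ℝ (Fin d) → ℝ) : Prop :=
  ContDiff ℝ ∞ h ∧ HasCompactSupport h ∧ tsupport h ⊆ V

/-- The kernel `K_β(x) = |x|^β` on `ℝ^d`. -/
def kernelK {d : ℕ} (β : ℝ) (x : EuclideanSpace ℝ (Fin d)) : ℝ :=
  ‖x‖ ^ β

/-- The convolution `(K_β g)(x) = ∫ K_β(x - y) g(y) dy`. -/
def potentialK {d : ℕ} (β : ℝ) (g : EuclideanSpace ℝ (Fin d) → ℝ) :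
    EuclideanSpace ℝ (Fin d) → ℝ :=
  fun x => ∫ y, kernelK β (x - y) * g y

end RieszApprox

end

namespace RieszApprox

variable {d : ℕ}

/-! Write β = 2s - d and let * denote convolution. After dilation and cutoff, u is C^k-close on the
ball to a compactly supported C^k function g, hence to g * φ with φ a mollifier supported near 0.
Translating g and φ in opposite directions gives g * φ = F * h, with h a bump inside the source
annulus and F continuous.

For x in the ball and y in the source annulus, x - y stays in a compact annulus away from 0, so only
F on that annulus matters. All derivatives of F * h can be put on h, so a uniform approximation of F
there is a C^k approximation of F * h (`abs_multiDeriv_kernelPotential_le`).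

It remains to approximate F uniformly by kernels G for which G * h is a Riesz potential of another
source. These G form a linear space containing |z|^β and stable under differentiation, since a
derivative of the kernel can be moved to the source (`kernelPotential_fderiv`). Laplacians and
directional derivatives produce ⟨v,z⟩^n |z|^(β-2n). Their exponential series sum to |z|^β exp⟨v,
z/|z|²⟩, and Stone–Weierstrass gives density (`reproducedRestrictions_topologicalClosure`). -/

/-! ### Iterated partial derivatives, as words in the coordinate directions -/

theorem exists_list_multiDeriv (α : Fin d → ℕ) :
    ∃ L : List (Fin d), L.length = ∑ i, α i ∧
      ∀ φ : EuclideanSpace ℝ (Fin d) → ℝ, multiDeriv α φ = L.foldr partialDeriv φ := by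
  have key : ∀ l : List (Fin d), ∃ L : List (Fin d), L.length = (l.map α).sum ∧
      ∀ φ : EuclideanSpace ℝ (Fin d) → ℝ,
        l.foldr (fun i ψ => (partialDeriv i)^[α i] ψ) φ = L.foldr partialDeriv φ := by
    intro l
    induction l with
    | nil => exact ⟨[], rfl, fun _ => rfl⟩
    | cons i l ih =>
      obtain ⟨L, hL, h⟩ := ih
      refine ⟨List.replicate (α i) i ++ L, by simp [hL], fun φ => ?_⟩
      rw [List.foldr_cons, h, List.foldr_append]
      generalize L.foldr partialDeriv φ = ψ
      induction α i with
      | zero => rfl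
      | succ n ihn => rw [Function.iterate_succ_apply', ihn, List.replicate_succ, List.foldr_cons]
  obtain ⟨L, hL, h⟩ := key (List.finRange d)
  exact ⟨L, by rw [hL, Fin.sum_univ_def], h⟩

theorem partialDeriv_eqOn {U : Set (EuclideanSpace ℝ (Fin d))} (hU : IsOpen U)
    {f g : EuclideanSpace ℝ (Fin d) → ℝ} (h : Set.EqOn f g U) (i : Fin d) :
    Set.EqOn (partialDeriv i f) (partialDeriv i g) U := fun _ hx =>
  Filter.EventuallyEq.lineDeriv_eq (Filter.eventuallyEq_of_mem (hU.mem_nhds hx) h)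

theorem foldr_partialDeriv_eqOn {U : Set (EuclideanSpace ℝ (Fin d))} (hU : IsOpen U)
    {f g : EuclideanSpace ℝ (Fin d) → ℝ} (h : Set.EqOn f g U) (L : List (Fin d)) :
    Set.EqOn (L.foldr partialDeriv f) (L.foldr partialDeriv g) U := by
  induction L with
  | nil => exact h
  | cons i L ih => exact partialDeriv_eqOn hU ih i

theorem partialDeriv_eq_fderiv {f : EuclideanSpace ℝ (Fin d) → ℝ} {x : EuclideanSpace ℝ (Fin d)}
    (h : DifferentiableAt ℝ f x) (i : Fin d) :
    partialDeriv i f x = fderiv ℝ f x (EuclideanSpace.single i 1) :=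
  h.lineDeriv_eq_fderiv

theorem contDiffOn_partialDeriv {U : Set (EuclideanSpace ℝ (Fin d))} (hU : IsOpen U)
    {f : EuclideanSpace ℝ (Fin d) → ℝ} {n : ℕ} (h : ContDiffOn ℝ (n + 1 : ℕ) f U) (i : Fin d) :
    ContDiffOn ℝ n (partialDeriv i f) U := by
  have h1 : ContDiffOn ℝ n (fun x => fderiv ℝ f x (EuclideanSpace.single i 1)) U :=
    (h.fderiv_of_isOpen hU (by norm_cast)).clm_apply contDiffOn_const
  refine h1.congr fun x hx => partialDeriv_eq_fderiv ?_ i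
  exact (h.differentiableOn (by norm_cast)).differentiableAt (hU.mem_nhds hx)

theorem contDiffOn_foldr_partialDeriv {U : Set (EuclideanSpace ℝ (Fin d))} (hU : IsOpen U)
    {f : EuclideanSpace ℝ (Fin d) → ℝ} (L : List (Fin d)) (n : ℕ)
    (h : ContDiffOn ℝ (L.length + n : ℕ) f U) :
    ContDiffOn ℝ n (L.foldr partialDeriv f) U := by
  induction L generalizing n with
  | nil => simpa using h
  | cons i L ih =>
    refine contDiffOn_partialDeriv hU (ih (n + 1) ?_) i
    convert h using 2
    simp only [List.length_cons]; ring

theorem differentiableAt_foldr_partialDeriv {U : Set (EuclideanSpace ℝ (Fin d))} (hU : IsOpen U)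
    {f : EuclideanSpace ℝ (Fin d) → ℝ} {L : List (Fin d)} {k : ℕ} (hL : L.length + 1 ≤ k)
    (h : ContDiffOn ℝ k f U) {x : EuclideanSpace ℝ (Fin d)} (hx : x ∈ U) :
    DifferentiableAt ℝ (L.foldr partialDeriv f) x :=
  ((contDiffOn_foldr_partialDeriv hU L 1 (h.of_le (by exact_mod_cast hL))).differentiableOn
    (by norm_num)).differentiableAt (hU.mem_nhds hx)

theorem foldr_partialDeriv_sub {U : Set (EuclideanSpace ℝ (Fin d))} (hU : IsOpen U)
    {f g : EuclideanSpace ℝ (Fin d) → ℝ} {k : ℕ} (hf : ContDiffOn ℝ k f U)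
    (hg : ContDiffOn ℝ k g U) (L : List (Fin d)) (hL : L.length ≤ k) :
    Set.EqOn (L.foldr partialDeriv fun x => f x - g x)
      (fun x => L.foldr partialDeriv f x - L.foldr partialDeriv g x) U := by
  induction L with
  | nil => exact fun _ _ => rfl
  | cons i L ih =>
    intro x hx
    have hL' : L.length + 1 ≤ k := by simpa using hL
    have hf' := differentiableAt_foldr_partialDeriv hU hL' hf hx
    have hg' := differentiableAt_foldr_partialDeriv hU hL' hg hx
    simp only [List.foldr_cons]
    rw [partialDeriv_eqOn hU (ih (by lia)) i hx, partialDeriv_eq_fderiv hf',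
      partialDeriv_eq_fderiv hg', partialDeriv_eq_fderiv (hf'.fun_sub hg'),
      fderiv_fun_sub hf' hg']
    rfl

/-- The factor `c` makes the formula iterable: each derivative replaces `c` by `c * t`. -/
theorem partialDeriv_comp_dilation (f : EuclideanSpace ℝ (Fin d) → ℝ) (c t : ℝ)
    (a : EuclideanSpace ℝ (Fin d)) (i : Fin d) :
    partialDeriv i (fun x => c * f (a + t • (x - a))) =
      fun x => c * t * partialDeriv i f (a + t • (x - a)) := by
  funext x
  have e : (fun τ : ℝ => c * f (a + t • (x + τ • EuclideanSpace.single i 1 - a))) =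
      fun τ => c * (fun σ : ℝ => f (a + t • (x - a) + σ • EuclideanSpace.single i 1)) (t * τ) := by
    funext τ
    congr 2
    module
  simp only [partialDeriv, lineDeriv]
  rw [e, deriv_const_mul_field, deriv_comp_mul_left t
    (fun σ : ℝ => f (a + t • (x - a) + σ • EuclideanSpace.single i 1)) 0]
  simp [mul_assoc]

theorem foldr_partialDeriv_comp_dilation (f : EuclideanSpace ℝ (Fin d) → ℝ) (t : ℝ)
    (a : EuclideanSpace ℝ (Fin d)) (L : List (Fin d)) :
    (L.foldr partialDeriv fun x => f (a + t • (x - a))) =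
      fun x => t ^ L.length * L.foldr partialDeriv f (a + t • (x - a)) := by
  induction L with
  | nil => simp
  | cons i L ih =>
    simp only [List.foldr_cons, ih, partialDeriv_comp_dilation, List.length_cons, pow_succ]

theorem contDiff_foldr_partialDeriv {f : EuclideanSpace ℝ (Fin d) → ℝ} (L : List (Fin d)) (n : ℕ)
    (h : ContDiff ℝ (L.length + n : ℕ) f) : ContDiff ℝ n (L.foldr partialDeriv f) :=
  contDiffOn_univ.1 (contDiffOn_foldr_partialDeriv isOpen_univ L n (contDiffOn_univ.2 h))

theorem hasCompactSupport_partialDeriv {f : EuclideanSpace ℝ (Fin d) → ℝ}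
    (h : HasCompactSupport f) (hf : Differentiable ℝ f) (i : Fin d) :
    HasCompactSupport (partialDeriv i f) := by
  have : partialDeriv i f = fun x => fderiv ℝ f x (EuclideanSpace.single i 1) :=
    funext fun x => partialDeriv_eq_fderiv (hf x) i
  rw [this]
  exact h.fderiv_apply ℝ _

theorem hasCompactSupport_foldr_partialDeriv {f : EuclideanSpace ℝ (Fin d) → ℝ}
    (h : HasCompactSupport f) (L : List (Fin d)) (hf : ContDiff ℝ L.length f) :
    HasCompactSupport (L.foldr partialDeriv f) := by
  induction L with
  | nil => exact h
  | cons i L ih =>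
    refine hasCompactSupport_partialDeriv (ih (hf.of_le (by norm_cast; simp))) ?_ i
    exact (contDiff_foldr_partialDeriv L 1 (by simpa using hf)).differentiable (by norm_num)

open scoped Convolution in
theorem partialDeriv_convolution {f g : EuclideanSpace ℝ (Fin d) → ℝ}
    (hf : LocallyIntegrable f volume) (hg : HasCompactSupport g) (hg' : ContDiff ℝ 1 g)
    (i : Fin d) :
    partialDeriv i (f ⋆[ContinuousLinearMap.mul ℝ ℝ] g) =
      f ⋆[ContinuousLinearMap.mul ℝ ℝ] partialDeriv i g := by
  funext x
  have H := hg.hasFDerivAt_convolution_right (ContinuousLinearMap.mul ℝ ℝ) hf hg' x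
  rw [partialDeriv_eq_fderiv H.differentiableAt, H.fderiv,
    convolution_precompR_apply _ hf (hg.fderiv ℝ) (hg'.continuous_fderiv (by norm_num))]
  congr 1
  funext y
  exact (partialDeriv_eq_fderiv (hg'.differentiable (by norm_num) y) i).symm

open scoped Convolution in
theorem foldr_partialDeriv_convolution {f g : EuclideanSpace ℝ (Fin d) → ℝ}
    (hf : LocallyIntegrable f volume) (hg : HasCompactSupport g) (L : List (Fin d))
    (hg' : ContDiff ℝ L.length g) :
    L.foldr partialDeriv (f ⋆[ContinuousLinearMap.mul ℝ ℝ] g) =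
      f ⋆[ContinuousLinearMap.mul ℝ ℝ] L.foldr partialDeriv g := by
  induction L with
  | nil => rfl
  | cons i L ih =>
    have hL : ContDiff ℝ L.length g := hg'.of_le (by norm_cast; simp)
    rw [List.foldr_cons, ih hL, partialDeriv_convolution hf
      (hasCompactSupport_foldr_partialDeriv hg L hL)
      (contDiff_foldr_partialDeriv L 1 (by simpa using hg'))]
    rfl

/-! ### Potentials of sources in the annulus -/

/-- The convolution `∫ F(x - y) h(y) dy` with a general kernel `F`. -/
noncomputable def kernelPotential (F h : EuclideanSpace ℝ (Fin d) → ℝ) (x : EuclideanSpace ℝ (Fin d)) : ℝ :=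
  ∫ y, F (x - y) * h y

/-- The annulus carrying the sources. -/
abbrev sourceAnnulus (a : EuclideanSpace ℝ (Fin d)) (r : ℝ) : Set (EuclideanSpace ℝ (Fin d)) :=
  ball a (4 * r) \ closedBall a (3 * r)

/-- An annulus containing all differences between points of the ball and points of
`sourceAnnulus`. -/
abbrev differenceAnnulus (d : ℕ) (r : ℝ) : Set (EuclideanSpace ℝ (Fin d)) :=
  closedBall 0 (5 * r) \ ball 0 (2 * r)

variable {a : EuclideanSpace ℝ (Fin d)} {r : ℝ}

theorem sub_mem_differenceAnnulus {x y : EuclideanSpace ℝ (Fin d)} (hx : x ∈ ball a r)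
    (hy : y ∈ sourceAnnulus a r) : x - y ∈ differenceAnnulus d r := by
  simp only [Set.mem_sdiff, mem_ball, mem_closedBall, not_le, not_lt, dist_zero_right,
    ← dist_eq_norm] at *
  have h1 := dist_triangle x a y
  have h2 := dist_triangle_left y a x
  rw [dist_comm a y] at h1
  constructor <;> linarith

theorem ne_zero_of_mem_differenceAnnulus (hr : 0 < r) {z : EuclideanSpace ℝ (Fin d)}
    (hz : z ∈ differenceAnnulus d r) : z ≠ 0 := by
  rintro rfl
  exact hz.2 (mem_ball_self (by linarith))

theorem eq_zero_of_notMem {V : Set (EuclideanSpace ℝ (Fin d))}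
    {h : EuclideanSpace ℝ (Fin d) → ℝ} (hh : IsTestFunction V h)
    {y : EuclideanSpace ℝ (Fin d)} (hy : y ∉ V) : h y = 0 :=
  image_eq_zero_of_notMem_tsupport fun h' => hy (hh.2.2 h')

/-- This allows a kernel to be altered or truncated near its singularity at 0. -/
theorem kernelPotential_congr {F G h : EuclideanSpace ℝ (Fin d) → ℝ}
    (hh : IsTestFunction (sourceAnnulus a r) h) (hFG : Set.EqOn F G (differenceAnnulus d r)) :
    Set.EqOn (kernelPotential F h) (kernelPotential G h) (ball a r) := by
  intro x hx
  refine integral_congr_ae (.of_forall fun y => ?_)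
  by_cases hy : y ∈ sourceAnnulus a r
  · simp only [hFG (sub_mem_differenceAnnulus hx hy)]
  · simp only [eq_zero_of_notMem hh hy, mul_zero]

theorem integrable_kernel_mul (hr : 0 < r) {F h : EuclideanSpace ℝ (Fin d) → ℝ}
    (hF : ContinuousOn F {0}ᶜ) (hh : IsTestFunction (sourceAnnulus a r) h)
    {x : EuclideanSpace ℝ (Fin d)} (hx : x ∈ ball a r) :
    Integrable (fun y => F (x - y) * h y) := by
  refine Continuous.integrable_of_hasCompactSupport ?_ (hh.2.1.mul_left)
  refine continuous_of_tsupport fun y hy => ?_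
  have hy' : x - y ≠ 0 := ne_zero_of_mem_differenceAnnulus hr
    (sub_mem_differenceAnnulus hx (hh.2.2 (tsupport_mul_subset_right hy)))
  refine ContinuousAt.mul ?_ hh.1.continuous.continuousAt
  exact ContinuousAt.comp (f := fun y => x - y) (hF.continuousAt (isOpen_compl_singleton.mem_nhds hy'))
    (by fun_prop)

theorem IsTestFunction.add {V : Set (EuclideanSpace ℝ (Fin d))}
    {g h : EuclideanSpace ℝ (Fin d) → ℝ} (hg : IsTestFunction V g) (hh : IsTestFunction V h) :
    IsTestFunction V (fun x => g x + h x) :=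
  ⟨hg.1.add hh.1, hg.2.1.add hh.2.1,
    (tsupport_add g h).trans (Set.union_subset hg.2.2 hh.2.2)⟩

theorem IsTestFunction.const_mul {V : Set (EuclideanSpace ℝ (Fin d))} (c : ℝ)
    {h : EuclideanSpace ℝ (Fin d) → ℝ} (hh : IsTestFunction V h) :
    IsTestFunction V (fun x => c * h x) :=
  ⟨contDiff_const.mul hh.1, hh.2.1.mul_left,
    (tsupport_mul_subset_right (f := fun _ => c)).trans hh.2.2⟩

theorem IsTestFunction.fderiv_apply {V : Set (EuclideanSpace ℝ (Fin d))}
    {h : EuclideanSpace ℝ (Fin d) → ℝ} (hh : IsTestFunction V h)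
    (v : EuclideanSpace ℝ (Fin d)) : IsTestFunction V (fun x => fderiv ℝ h x v) :=
  ⟨(hh.1.fderiv_right (m := ∞) (by simp)).clm_apply contDiff_const, hh.2.1.fderiv_apply ℝ v,
    (tsupport_fderiv_apply_subset ℝ v).trans hh.2.2⟩

/-- Integration by parts in y, without boundary term because `h` has compact support in the annulus.
Its sign cancels the one from differentiating `F (x - y)` in y. -/
theorem kernelPotential_fderiv (hr : 0 < r) {F h : EuclideanSpace ℝ (Fin d) → ℝ}
    (hF : ContDiffOn ℝ ∞ F {0}ᶜ) (hh : IsTestFunction (sourceAnnulus a r) h)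
    (v : EuclideanSpace ℝ (Fin d)) {x : EuclideanSpace ℝ (Fin d)} (hx : x ∈ ball a r) :
    kernelPotential (fun z => fderiv ℝ F z v) h x =
      kernelPotential F (fun y => fderiv ℝ h y v) x := by
  have hF' : ContinuousOn (fun z => fderiv ℝ F z v) {0}ᶜ :=
    (hF.continuousOn_fderiv_of_isOpen isOpen_compl_singleton (by simp)).clm_apply
      continuousOn_const
  have hd : ∀ y ∈ sourceAnnulus a r, HasFDerivAt (fun y => F (x - y))
      (-(fderiv ℝ F (x - y))) y := by
    intro y hy
    have hy' : x - y ≠ 0 := ne_zero_of_mem_differenceAnnulus hr (sub_mem_differenceAnnulus hx hy)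
    have h1 : DifferentiableAt ℝ F (x - y) := (hF.differentiableOn (by simp)).differentiableAt
      (isOpen_compl_singleton.mem_nhds hy')
    have h2 := h1.hasFDerivAt.comp y ((hasFDerivAt_id y).const_sub x)
    exact h2.congr_fderiv (by ext w; simp)
  have e : (fun y => fderiv ℝ (fun y => F (x - y)) y v * h y) =
      fun y => -(fderiv ℝ F (x - y) v * h y) := by
    funext y
    by_cases hy : y ∈ sourceAnnulus a r
    · rw [(hd y hy).fderiv]; simp
    · simp [eq_zero_of_notMem hh hy]
  have := integral_mul_fderiv_eq_neg_fderiv_mul_of_integrable (μ := volume)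
    (f := fun y => F (x - y)) (g := h) (v := v) (by
      rw [e]; exact (integrable_kernel_mul hr hF' hh hx).neg)
    (integrable_kernel_mul hr hF.continuousOn (hh.fderiv_apply v) hx)
    (integrable_kernel_mul hr hF.continuousOn hh hx)
    (fun y hy => (hd y (hh.2.2 hy)).differentiableAt)
    (fun y _ => hh.1.differentiable (by simp) y)
  rw [e, integral_neg, neg_neg] at this
  exact this.symm

/-! ### Kernels generated by the Riesz kernel -/

/-- The kernels `F`, smooth away from the origin, whose potentials of sources in the annulus are,
in the ball, Riesz potentials of sources in the annulus. -/
def reproducedKernels (β : ℝ) (a : EuclideanSpace ℝ (Fin d)) {r : ℝ} (hr : 0 < r) :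
    Submodule ℝ (EuclideanSpace ℝ (Fin d) → ℝ) where
  carrier := {F | ContDiffOn ℝ ∞ F {0}ᶜ ∧ ∀ h, IsTestFunction (sourceAnnulus a r) h →
    ∃ h', IsTestFunction (sourceAnnulus a r) h' ∧
      Set.EqOn (kernelPotential F h) (potentialK β h') (ball a r)}
  zero_mem' := ⟨contDiffOn_const, fun _ _ => ⟨fun _ => 0,
    ⟨contDiff_const, HasCompactSupport.zero, by simp [tsupport, Function.support]⟩,
    fun _ _ => by simp [kernelPotential, potentialK]⟩⟩
  add_mem' := by
    rintro F G ⟨hF, hF'⟩ ⟨hG, hG'⟩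
    refine ⟨hF.add hG, fun h hh => ?_⟩
    obtain ⟨f, hf, hf'⟩ := hF' h hh
    obtain ⟨g, hg, hg'⟩ := hG' h hh
    refine ⟨_, hf.add hg, fun x hx => ?_⟩
    have hK : ContinuousOn (kernelK β : EuclideanSpace ℝ (Fin d) → ℝ) {0}ᶜ :=
      continuous_norm.continuousOn.rpow_const fun z hz => Or.inl (norm_ne_zero_iff.2 hz)
    have e1 : kernelPotential (F + G) h x = kernelPotential F h x + kernelPotential G h x := by
      simp only [kernelPotential, Pi.add_apply, add_mul]
      exact integral_add (integrable_kernel_mul hr hF.continuousOn hh hx)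
        (integrable_kernel_mul hr hG.continuousOn hh hx)
    rw [e1, hf' hx, hg' hx]
    simp only [potentialK, mul_add]
    exact (integral_add (integrable_kernel_mul hr hK hf hx)
      (integrable_kernel_mul hr hK hg hx)).symm
  smul_mem' := by
    rintro c F ⟨hF, hF'⟩
    refine ⟨contDiffOn_const.smul hF, fun h hh => ?_⟩
    obtain ⟨f, hf, hf'⟩ := hF' h hh
    refine ⟨_, hf.const_mul c, fun x hx => ?_⟩
    have := hf' hx
    simp only [kernelPotential, potentialK, Pi.smul_apply, smul_eq_mul, mul_assoc,
      mul_left_comm _ c, integral_const_mul] at this ⊢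
    rw [this]

/-- The value at 0 is never used, so derivative formulas need hold only away from 0. -/
theorem mem_reproducedKernels_congr {β : ℝ} (hr : 0 < r)
    {F G : EuclideanSpace ℝ (Fin d) → ℝ} (hF : F ∈ reproducedKernels β a hr)
    (hFG : ∀ z ≠ 0, G z = F z) : G ∈ reproducedKernels β a hr := by
  refine ⟨hF.1.congr hFG, fun h hh => ?_⟩
  obtain ⟨f, hf, hf'⟩ := hF.2 h hh
  refine ⟨f, hf, fun x hx => ?_⟩
  rw [← hf' hx]
  exact kernelPotential_congr hh (fun z hz => hFG z (ne_zero_of_mem_differenceAnnulus hr hz)) hx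

theorem contDiffOn_norm_rpow (p : ℝ) :
    ContDiffOn ℝ ∞ (fun z : EuclideanSpace ℝ (Fin d) => ‖z‖ ^ p) {0}ᶜ := by
  refine ContDiffOn.rpow_const_of_ne (fun z hz => ?_) fun z hz => norm_ne_zero_iff.2 hz
  exact (contDiffAt_norm ℝ hz).contDiffWithinAt

theorem kernelK_mem_reproducedKernels (β : ℝ) (a : EuclideanSpace ℝ (Fin d)) (hr : 0 < r) :
    (fun z => ‖z‖ ^ β) ∈ reproducedKernels β a hr :=
  ⟨contDiffOn_norm_rpow β, fun h hh => ⟨h, hh, fun _ _ => rfl⟩⟩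

theorem fderiv_mem_reproducedKernels {β : ℝ} (hr : 0 < r)
    {F : EuclideanSpace ℝ (Fin d) → ℝ} (hF : F ∈ reproducedKernels β a hr)
    (v : EuclideanSpace ℝ (Fin d)) :
    (fun z => fderiv ℝ F z v) ∈ reproducedKernels β a hr := by
  refine ⟨(hF.1.fderiv_of_isOpen isOpen_compl_singleton (by simp)).clm_apply contDiffOn_const,
    fun h hh => ?_⟩
  obtain ⟨f, hf, hf'⟩ := hF.2 _ (hh.fderiv_apply v)
  exact ⟨f, hf, fun x hx => (kernelPotential_fderiv hr hF.1 hh v hx).trans (hf' hx)⟩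

theorem mem_reproducedKernels_of_hasFDerivAt {β : ℝ} (hr : 0 < r)
    {F G : EuclideanSpace ℝ (Fin d) → ℝ}
    {F' : EuclideanSpace ℝ (Fin d) → EuclideanSpace ℝ (Fin d) →L[ℝ] ℝ}
    (hF : F ∈ reproducedKernels β a hr) (v : EuclideanSpace ℝ (Fin d))
    (hF' : ∀ z ≠ 0, HasFDerivAt F (F' z) z) (hG : ∀ z ≠ 0, G z = F' z v) :
    G ∈ reproducedKernels β a hr :=
  mem_reproducedKernels_congr hr (fderiv_mem_reproducedKernels hr hF v) fun z hz => by
    rw [hG z hz, (hF' z hz).fderiv]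

theorem hasFDerivAt_norm_rpow_of_ne (p : ℝ) {z : EuclideanSpace ℝ (Fin d)} (hz : z ≠ 0) :
    HasFDerivAt (fun z : EuclideanSpace ℝ (Fin d) => ‖z‖ ^ p)
      ((p * ‖z‖ ^ (p - 2)) • innerSL ℝ z) z := by
  have hz' : 0 < ‖z‖ := norm_pos_iff.2 hz
  have h1 := (HasFDerivAt.norm_sq (hasFDerivAt_id z)).rpow_const (p := p / 2)
    (Or.inl (by simpa using hz))
  have e : (fun z : EuclideanSpace ℝ (Fin d) => ‖z‖ ^ p) = fun z => (‖id z‖ ^ 2) ^ (p / 2) := by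
    funext z
    rw [id, ← Real.rpow_natCast, ← Real.rpow_mul (norm_nonneg z)]
    congr 1
    push_cast; ring
  rw [e]
  have e2 : (‖z‖ ^ 2) ^ (p / 2 - 1) = ‖z‖ ^ (p - 2) := by
    rw [← Real.rpow_natCast, ← Real.rpow_mul (norm_nonneg z)]
    congr 1
    push_cast; ring
  refine h1.congr_fderiv ?_
  ext w
  simp [e2]
  ring

/-- Powers of the norm obtained from the Riesz kernel by repeatedly applying the Laplacian. -/
theorem norm_rpow_mem_reproducedKernels {β : ℝ} (a : EuclideanSpace ℝ (Fin d)) (hr : 0 < r)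
    (hβ : β < 0) (hβd : β + d < 2) (m : ℕ) :
    (fun z => ‖z‖ ^ (β - 2 * m)) ∈ reproducedKernels β a hr := by
  induction m with
  | zero => simpa using kernelK_mem_reproducedKernels β a hr
  | succ m ih =>
    set p : ℝ := β - 2 * m with hp
    have hm : (0 : ℝ) ≤ m := m.cast_nonneg
    have h1 : ∀ i : Fin d, (fun z : EuclideanSpace ℝ (Fin d) => p * ‖z‖ ^ (p - 2) * z i) ∈
        reproducedKernels β a hr := fun i =>
      mem_reproducedKernels_of_hasFDerivAt hr ih (EuclideanSpace.single i 1)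
        (fun z hz => hasFDerivAt_norm_rpow_of_ne p hz) (fun z _ => by
          simp [EuclideanSpace.inner_single_right])
    have h2 : ∀ i : Fin d, (fun z : EuclideanSpace ℝ (Fin d) =>
        p * ‖z‖ ^ (p - 2) + p * (p - 2) * ‖z‖ ^ (p - 4) * z i ^ 2) ∈
        reproducedKernels β a hr := fun i =>
      mem_reproducedKernels_of_hasFDerivAt hr (h1 i) (EuclideanSpace.single i 1)
        (fun z hz => ((hasFDerivAt_norm_rpow_of_ne (p - 2) hz).const_mul p).mul
          (EuclideanSpace.proj i : EuclideanSpace ℝ (Fin d) →L[ℝ] ℝ).hasFDerivAt)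
        (fun z _ => by
          have : p - 2 - 2 = p - 4 := by ring
          simp [this, EuclideanSpace.inner_single_right]; ring)
    -- The Laplacian of |z|^p is p(p+d-2)|z|^(p-2). Here p ≤ β < 0 and p+d-2 ≤ β+d-2 < 0, so it can
    -- be divided out.
    have hc : p * (d + p - 2) ≠ 0 := by
      apply mul_ne_zero <;> rw [hp] <;> linarith
    refine mem_reproducedKernels_congr hr (Submodule.smul_mem _ (p * (d + p - 2))⁻¹
      (Submodule.sum_mem _ fun i (_ : i ∈ Finset.univ) => h2 i)) fun z hz => ?_
    have hz' : 0 < ‖z‖ := norm_pos_iff.2 hz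
    have e1 : ‖z‖ ^ (p - 2) = ‖z‖ ^ (p - 4) * ‖z‖ ^ 2 := by
      rw [← Real.rpow_natCast, ← Real.rpow_add hz']
      congr 1
      push_cast; ring
    have e2 : β - 2 * ((m + 1 : ℕ) : ℝ) = p - 2 := by rw [hp]; push_cast; ring
    simp only [Pi.smul_apply, Finset.sum_apply, smul_eq_mul, Finset.sum_add_distrib,
      ← Finset.mul_sum, Finset.sum_const, Finset.card_univ, Fintype.card_fin, nsmul_eq_mul]
    rw [e2, ← EuclideanSpace.real_norm_sq_eq, mul_assoc (p * (p - 2)), ← e1,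
      eq_inv_mul_iff_mul_eq₀ hc]
    ring

/-- Differentiating ⟨v,z⟩^n |z|^(β-2m) along v gives n|v|²⟨v,z⟩^(n-1)|z|^(β-2m) +
(β-2m)⟨v,z⟩^(n+1)|z|^(β-2(m+1)). The first term is already available and β-2m ≠ 0, so n and m rise
together. -/
theorem inner_pow_mul_norm_rpow_mem_reproducedKernels {β : ℝ} (a : EuclideanSpace ℝ (Fin d))
    (hr : 0 < r) (hβ : β < 0) (hβd : β + d < 2) (v : EuclideanSpace ℝ (Fin d)) (n m : ℕ)
    (hnm : n ≤ m) :
    (fun z => inner ℝ v z ^ n * ‖z‖ ^ (β - 2 * m)) ∈ reproducedKernels β a hr := by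
  induction n using Nat.strong_induction_on generalizing m with
  | _ n ih =>
    match n, m, hnm with
    | 0, m, _ => simpa using norm_rpow_mem_reproducedKernels a hr hβ hβd m
    | n + 1, m + 1, hnm =>
      have hm : (0 : ℝ) ≤ m := m.cast_nonneg
      have hc : β - 2 * m ≠ 0 := by linarith
      have e : β - 2 * ((m + 1 : ℕ) : ℝ) = β - 2 * m - 2 := by push_cast; ring
      have h1 := ih n (Nat.lt_succ_self n) m (by lia)
      -- At n = 0 the truncated exponent n - 1 is harmless: the factor n vanishes.
      have h2 : (fun z => n * ‖v‖ ^ 2 * (inner ℝ v z ^ (n - 1) * ‖z‖ ^ (β - 2 * m))) ∈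
          reproducedKernels β a hr :=
        Submodule.smul_mem _ (n * ‖v‖ ^ 2) (ih (n - 1) (by lia) m (by lia))
      have h3 : (fun z => n * ‖v‖ ^ 2 * (inner ℝ v z ^ (n - 1) * ‖z‖ ^ (β - 2 * m)) +
          (β - 2 * m) * (inner ℝ v z ^ (n + 1) * ‖z‖ ^ (β - 2 * (m + 1 : ℕ)))) ∈
          reproducedKernels β a hr :=
        mem_reproducedKernels_of_hasFDerivAt hr h1 v
          (fun z hz => ((innerSL ℝ v).hasFDerivAt.pow n).mul
            (hasFDerivAt_norm_rpow_of_ne (β - 2 * m) hz))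
          (fun z _ => by
            rw [e]
            simp [real_inner_comm v z]
            ring)
      refine mem_reproducedKernels_congr hr (Submodule.smul_mem _ (β - 2 * m)⁻¹
        (Submodule.sub_mem _ h3 h2)) fun z _ => ?_
      simp only [Pi.smul_apply, Pi.sub_apply, smul_eq_mul]
      field_simp
      ring

/-! ### Density on the difference annulus by Stone–Weierstrass -/

theorem isCompact_differenceAnnulus (d : ℕ) (r : ℝ) : IsCompact (differenceAnnulus d r) :=
  (isCompact_closedBall _ _).diff isOpen_ball

/-- The linear function `⟨v, z⟩` composed with the inversion `z ↦ z / |z|²`. -/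
noncomputable def inversionCoord (hr : 0 < r) (v : EuclideanSpace ℝ (Fin d)) :
    C(differenceAnnulus d r, ℝ) where
  toFun z := inner ℝ v z.1 * (‖z.1‖ ^ 2)⁻¹
  continuous_toFun := by
    refine Continuous.mul (by fun_prop) (Continuous.inv₀ (by fun_prop) fun z => ?_)
    have := norm_pos_iff.2 (ne_zero_of_mem_differenceAnnulus hr z.2)
    positivity

/-- The power `|z|^p` on the annulus. -/
noncomputable def normRpow (d : ℕ) (hr : 0 < r) (p : ℝ) : C(differenceAnnulus d r, ℝ) where
  toFun z := ‖z.1‖ ^ p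
  continuous_toFun := (by fun_prop : Continuous fun z : differenceAnnulus d r =>
    ‖z.1‖).rpow_const fun z =>
      Or.inl (norm_ne_zero_iff.2 (ne_zero_of_mem_differenceAnnulus hr z.2))

/-- The restrictions to the annulus of the reproduced kernels. -/
noncomputable def reproducedRestrictions (β : ℝ) (a : EuclideanSpace ℝ (Fin d)) (hr : 0 < r) :
    Submodule ℝ C(differenceAnnulus d r, ℝ) where
  carrier := {f | ∃ F ∈ reproducedKernels β a hr, ∀ z : differenceAnnulus d r, f z = F z}
  zero_mem' := ⟨0, Submodule.zero_mem _, fun _ => rfl⟩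
  add_mem' := by
    rintro f g ⟨F, hF, hf⟩ ⟨G, hG, hg⟩
    exact ⟨F + G, Submodule.add_mem _ hF hG, fun z => by simp [hf, hg]⟩
  smul_mem' := by
    rintro c f ⟨F, hF, hf⟩
    exact ⟨c • F, Submodule.smul_mem _ c hF, fun z => by simp [hf]⟩

/-- The partial sums of |z|^β exp⟨v, z/|z|²⟩ are combinations of ⟨v,z⟩^n |z|^(β-2n), and the series
converges in the Banach algebra of continuous functions on the annulus. -/
theorem normRpow_mul_exp_mem {β : ℝ} (a : EuclideanSpace ℝ (Fin d)) (hr : 0 < r) (hβ : β < 0)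
    (hβd : β + d < 2) (v : EuclideanSpace ℝ (Fin d)) :
    have := isCompact_iff_compactSpace.1 (isCompact_differenceAnnulus d r)
    normRpow d hr β * NormedSpace.exp (inversionCoord hr v) ∈
      (reproducedRestrictions β a hr).topologicalClosure := by
  have := isCompact_iff_compactSpace.1 (isCompact_differenceAnnulus d r)
  have hs := (NormedSpace.exp_series_hasSum_exp' (𝕂 := ℝ) (inversionCoord hr v)).mul_left
    (normRpow d hr β)
  refine (Submodule.isClosed_topologicalClosure _).mem_of_tendsto hs
    (.of_forall fun N => Submodule.sum_mem _ fun n _ => ?_)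
  refine Submodule.le_topologicalClosure _ ⟨_, Submodule.smul_mem _ (n.factorial : ℝ)⁻¹
    (inner_pow_mul_norm_rpow_mem_reproducedKernels a hr hβ hβd v n n le_rfl), fun z => ?_⟩
  have hz : 0 < ‖z.1‖ := norm_pos_iff.2 (ne_zero_of_mem_differenceAnnulus hr z.2)
  have e : ‖z.1‖ ^ (β - 2 * n) = ‖z.1‖ ^ β * ((‖z.1‖ ^ 2)⁻¹) ^ n := by
    rw [Real.rpow_sub hz, div_eq_mul_inv, inv_pow, ← pow_mul]
    congr 2
    exact_mod_cast Real.rpow_natCast ‖z.1‖ (2 * n)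
  simp only [ContinuousMap.mul_apply, ContinuousMap.smul_apply, ContinuousMap.pow_apply,
    Pi.smul_apply, smul_eq_mul, normRpow, inversionCoord, ContinuousMap.coe_mk, e, mul_pow]
  ring

theorem exp_inversionCoord_apply (hr : 0 < r) (v : EuclideanSpace ℝ (Fin d))
    (z : differenceAnnulus d r) :
    have := isCompact_iff_compactSpace.1 (isCompact_differenceAnnulus d r)
    NormedSpace.exp (inversionCoord hr v) z = Real.exp (inner ℝ v z.1 * (‖z.1‖ ^ 2)⁻¹) := by
  have := isCompact_iff_compactSpace.1 (isCompact_differenceAnnulus d r)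
  rw [Real.exp_eq_exp_ℝ]
  exact NormedSpace.map_exp (ContinuousMap.evalAlgHom ℝ ℝ z) (continuous_eval_const z)
    (inversionCoord hr v)

/-- The exponentials `exp ⟨v, z / |z|²⟩` as a monoid homomorphism in `v`. -/
noncomputable def expInversion (hr : 0 < r) :
    Multiplicative (EuclideanSpace ℝ (Fin d)) →* C(differenceAnnulus d r, ℝ) where
  toFun v :=
    have := isCompact_iff_compactSpace.1 (isCompact_differenceAnnulus d r)
    NormedSpace.exp (inversionCoord hr v.toAdd)
  map_one' := by
    ext z
    simp [exp_inversionCoord_apply]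
  map_mul' v w := by
    ext z
    simp [exp_inversionCoord_apply, inner_add_left, add_mul, Real.exp_add]

/-- Inversion is injective: testing with v = z and v = w gives ⟨z,w⟩ = |w|² = |z|², hence |z - w|² =
0. -/
theorem separatesPoints_adjoin_expInversion (d : ℕ) (hr : 0 < r) :
    (Algebra.adjoin ℝ (MonoidHom.mrange (expInversion (d := d) hr) :
      Set C(differenceAnnulus d r, ℝ))).SeparatesPoints := by
  intro z w hzw
  by_contra! H
  have key : ∀ v : EuclideanSpace ℝ (Fin d),
      inner ℝ v z.1 * (‖z.1‖ ^ 2)⁻¹ = inner ℝ v w.1 * (‖w.1‖ ^ 2)⁻¹ := by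
    intro v
    have := H _ ⟨expInversion hr (Multiplicative.ofAdd v),
      Algebra.subset_adjoin ⟨_, rfl⟩, rfl⟩
    simpa [expInversion, exp_inversionCoord_apply] using this
  have hz : 0 < ‖z.1‖ := norm_pos_iff.2 (ne_zero_of_mem_differenceAnnulus hr z.2)
  have hw : 0 < ‖w.1‖ := norm_pos_iff.2 (ne_zero_of_mem_differenceAnnulus hr w.2)
  have h1 := key z.1
  have h2 := key w.1
  rw [real_inner_self_eq_norm_sq, mul_inv_cancel₀ (by positivity)] at h1 h2
  rw [real_inner_comm] at h2
  have h3 : inner ℝ z.1 w.1 = ‖w.1‖ ^ 2 := by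
    field_simp at h1; exact h1.symm
  have h4 : inner ℝ z.1 w.1 = ‖z.1‖ ^ 2 := by
    field_simp at h2; exact h2
  apply hzw
  ext1
  rw [← sub_eq_zero, ← norm_eq_zero, ← sq_eq_zero_iff, norm_sub_sq_real]
  linarith

theorem reproducedRestrictions_topologicalClosure {β : ℝ} (a : EuclideanSpace ℝ (Fin d))
    (hr : 0 < r) (hβ : β < 0) (hβd : β + d < 2) :
    (reproducedRestrictions β a hr).topologicalClosure = ⊤ := by
  have := isCompact_iff_compactSpace.1 (isCompact_differenceAnnulus d r)
  set A := Algebra.adjoin ℝ (MonoidHom.mrange (expInversion (d := d) hr) :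
    Set C(differenceAnnulus d r, ℝ)) with hA
  have hmem : ∀ f ∈ A, normRpow d hr β * f ∈
      (reproducedRestrictions β a hr).topologicalClosure := by
    intro f hf
    -- The exponentials are closed under multiplication, so the algebra they generate is their
    -- linear span.
    rw [hA, ← Subalgebra.mem_toSubmodule, Algebra.adjoin_eq_span, Submonoid.closure_eq] at hf
    induction hf using Submodule.span_induction with
    | mem f hf =>
      obtain ⟨v, rfl⟩ := hf
      exact normRpow_mul_exp_mem a hr hβ hβd v.toAdd
    | zero => simp
    | add f g _ _ hf hg => rw [mul_add]; exact Submodule.add_mem _ hf hg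
    | smul c f _ hf => rw [mul_smul_comm]; exact Submodule.smul_mem _ c hf
  rw [eq_top_iff]
  intro f _
  -- Approximate f/|z|^β by the algebra, then multiply back by |z|^β.
  have hden : normRpow d hr (-β) * f ∈ closure (A : Set C(differenceAnnulus d r, ℝ)) := by
    rw [← Subalgebra.topologicalClosure_coe,
      ContinuousMap.subalgebra_topologicalClosure_eq_top_of_separatesPoints _
        (separatesPoints_adjoin_expInversion d hr)]
    trivial
  have h2 := map_mem_closure (t := ((reproducedRestrictions β a hr).topologicalClosure :
    Set C(differenceAnnulus d r, ℝ))) (continuous_const_mul (normRpow d hr β)) hden hmem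
  rw [(Submodule.isClosed_topologicalClosure _).closure_eq, ← mul_assoc] at h2
  have e : normRpow d hr β * normRpow d hr (-β) = 1 := by
    ext z
    have hz : 0 < ‖z.1‖ := norm_pos_iff.2 (ne_zero_of_mem_differenceAnnulus hr z.2)
    simp [normRpow, ← Real.rpow_add hz]
  rwa [e, one_mul] at h2

theorem exists_reproducedKernel_near {β : ℝ} (a : EuclideanSpace ℝ (Fin d))
    (hr : 0 < r) (hβ : β < 0) (hβd : β + d < 2) {F : EuclideanSpace ℝ (Fin d) → ℝ}
    (hF : Continuous F) {η : ℝ} (hη : 0 < η) :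
    ∃ G ∈ reproducedKernels β a hr, ∀ z ∈ differenceAnnulus d r, |F z - G z| ≤ η := by
  have := isCompact_iff_compactSpace.1 (isCompact_differenceAnnulus d r)
  have h : (⟨fun z => F z.1, by fun_prop⟩ : C(differenceAnnulus d r, ℝ)) ∈
      (reproducedRestrictions β a hr).topologicalClosure := by
    rw [reproducedRestrictions_topologicalClosure a hr hβ hβd]; trivial
  obtain ⟨g, ⟨G, hG, hg⟩, hd⟩ := Metric.mem_closure_iff.1 h η hη
  refine ⟨G, hG, fun z hz => ?_⟩
  have := ((ContinuousMap.dist_lt_iff hη).1 hd ⟨z, hz⟩).le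
  rwa [hg, Real.dist_eq] at this

/-! ### Approximation of `u` by dilation, cutoff and mollification -/

theorem exists_bound_of_uniformContinuousOn {A : EuclideanSpace ℝ (Fin d) → ℝ}
    {B : Set (EuclideanSpace ℝ (Fin d))} (hB : Bornology.IsBounded B)
    (hA : UniformContinuousOn A B) : ∃ M, ∀ x ∈ B, |A x| ≤ M := by
  have h1 : TotallyBounded (Set.univ : Set B) := by
    have := totallyBounded_preimage
      (isUniformEmbedding_subtype_val (p := (· ∈ B))).isUniformInducing
      (hB.isCompact_closure.totallyBounded.subset subset_closure)
    simpa using this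
  have h2 := (h1.image (uniformContinuousOn_iff_restrict.1 hA)).isBounded
  obtain ⟨M, hM⟩ := h2.exists_norm_le
  exact ⟨M, fun x hx => hM _ ⟨⟨x, hx⟩, trivial, rfl⟩⟩

theorem dilation_mem_ball {t ρ : ℝ} (ht : 0 < t) {x : EuclideanSpace ℝ (Fin d)}
    (hx : x ∈ ball a ρ) : a + t • (x - a) ∈ ball a (t * ρ) := by
  rw [mem_ball, dist_eq_norm] at hx ⊢
  rw [add_sub_cancel_left, norm_smul, Real.norm_of_nonneg ht.le]
  exact mul_lt_mul_of_pos_left hx ht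

theorem eventually_dilation_near (hr : 0 < r) {A : EuclideanSpace ℝ (Fin d) → ℝ}
    (hA : UniformContinuousOn A (ball a r)) (n : ℕ) {η : ℝ} (hη : 0 < η) :
    ∀ᶠ t in nhdsWithin (1 : ℝ) (Set.Ioo 0 1), ∀ x ∈ ball a r,
      |t ^ n * A (a + t • (x - a)) - A x| ≤ η := by
  obtain ⟨M, hM⟩ := exists_bound_of_uniformContinuousOn isBounded_ball hA
  obtain ⟨δ, hδ, H⟩ := Metric.uniformContinuousOn_iff.1 hA (η / 2) (by positivity)
  have e1 : ∀ᶠ t in nhds (1 : ℝ), |t ^ n - 1| * M < η / 2 := by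
    have : Continuous fun t : ℝ => |t ^ n - 1| * M := by fun_prop
    exact this.continuousAt.eventually_lt continuousAt_const (by simpa using hη)
  have e2 : ∀ᶠ t in nhds (1 : ℝ), (1 - t) * r < δ := by
    have : Continuous fun t : ℝ => (1 - t) * r := by fun_prop
    exact this.continuousAt.eventually_lt continuousAt_const (by simpa using hδ)
  filter_upwards [self_mem_nhdsWithin, nhdsWithin_le_nhds e1, nhdsWithin_le_nhds e2]
    with t ht h1 h2 x hx
  have hp : a + t • (x - a) ∈ ball a r :=
    ball_subset_ball (by nlinarith [ht.2]) (dilation_mem_ball ht.1 hx)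
  have hd : dist (a + t • (x - a)) x < δ := by
    have : a + t • (x - a) - x = -((1 - t) • (x - a)) := by module
    rw [dist_eq_norm, this, norm_neg, norm_smul, Real.norm_of_nonneg (by linarith [ht.2])]
    rw [mem_ball, dist_eq_norm] at hx
    nlinarith [ht.2]
  have h3 := H _ hp _ hx hd
  rw [Real.dist_eq] at h3
  calc |t ^ n * A (a + t • (x - a)) - A x|
      = |(t ^ n - 1) * A (a + t • (x - a)) + (A (a + t • (x - a)) - A x)| := by ring_nf
    _ ≤ |(t ^ n - 1) * A (a + t • (x - a))| + |A (a + t • (x - a)) - A x| := abs_add_le _ _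
    _ ≤ |t ^ n - 1| * M + η / 2 := by
      rw [abs_mul]
      gcongr
      exact hM _ hp
    _ ≤ η := by linarith

/-- For t < 1 the dilate u(a + t(x - a)) is C^k on the larger ball of radius r/t, so a cutoff equal
to 1 on the original ball extends it by zero. No extension theorem is needed. -/
theorem exists_compactlySupported_near {k : ℕ} (hr : 0 < r)
    {u : EuclideanSpace ℝ (Fin d) → ℝ} (hu : MemCk k (ball a r) u) {η : ℝ} (hη : 0 < η) :
    ∃ g : EuclideanSpace ℝ (Fin d) → ℝ, ContDiff ℝ k g ∧ HasCompactSupport g ∧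
      ∀ α ∈ multiIndices d k, ∀ x ∈ ball a r, |multiDeriv α g x - multiDeriv α u x| ≤ η := by
  have hev : ∀ᶠ t in nhdsWithin (1 : ℝ) (Set.Ioo 0 1), ∀ α ∈ multiIndices d k, ∀ x ∈ ball a r,
      |t ^ (∑ i, α i) * multiDeriv α u (a + t • (x - a)) - multiDeriv α u x| ≤ η :=
    (Filter.eventually_all_finset _).2 fun α hα =>
      eventually_dilation_near hr (hu.2 α hα _ subset_rfl isBounded_ball) _ hη
  have : (nhdsWithin (1 : ℝ) (Set.Ioo 0 1)).NeBot := by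
    rw [← mem_closure_iff_nhdsWithin_neBot, closure_Ioo (by norm_num)]
    exact ⟨zero_le_one, le_rfl⟩
  obtain ⟨t, H, ht0, ht1⟩ := (hev.and self_mem_nhdsWithin).exists
  have hlt : r < r / t := by rw [lt_div_iff₀ ht0]; nlinarith
  obtain ⟨ρ, hρ1, hρ2⟩ := exists_between hlt
  let χ : ContDiffBump a := ⟨r, ρ, hr, hρ1⟩
  have hdil : ContDiffOn ℝ k (fun x => u (a + t • (x - a))) (ball a (r / t)) := by
    refine hu.1.comp (f := fun x => a + t • (x - a)) (by fun_prop) fun x hx => ?_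
    have := dilation_mem_ball ht0 hx
    rwa [mul_div_cancel₀ _ ht0.ne'] at this
  refine ⟨fun x => χ x * u (a + t • (x - a)), ?_, χ.hasCompactSupport.mul_right, ?_⟩
  · rw [contDiff_iff_contDiffAt]
    intro x
    by_cases hx : x ∈ ball a (r / t)
    · exact χ.contDiffAt.mul (hdil.contDiffAt (isOpen_ball.mem_nhds hx))
    · have hx' : x ∉ tsupport χ := by
        rw [χ.tsupport_eq]
        exact fun h => hx (closedBall_subset_ball hρ2 h)
      refine (contDiffAt_const (c := (0 : ℝ))).congr_of_eventuallyEq ?_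
      filter_upwards [notMem_tsupport_iff_eventuallyEq.1 hx'] with y hy
      simp [hy]
  · intro α hα x hx
    obtain ⟨L, hL, hL'⟩ := exists_list_multiDeriv α
    have heq : Set.EqOn (fun x => χ x * u (a + t • (x - a))) (fun x => u (a + t • (x - a)))
        (ball a r) := fun y hy => by
      simp [χ.one_of_mem_closedBall (ball_subset_closedBall hy)]
    have := H α hα x hx
    simp only [hL'] at this ⊢
    rwa [foldr_partialDeriv_eqOn isOpen_ball heq L hx, foldr_partialDeriv_comp_dilation, hL]

open scoped Convolution in
theorem kernelPotential_eq_convolution (F h : EuclideanSpace ℝ (Fin d) → ℝ) :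
    kernelPotential F h = F ⋆[ContinuousLinearMap.mul ℝ ℝ] h := by
  funext x
  rw [convolution_mul_swap]
  rfl

open scoped Convolution in
theorem kernelPotential_eq_convolution_swap (F h : EuclideanSpace ℝ (Fin d) → ℝ) :
    kernelPotential F h = h ⋆[ContinuousLinearMap.mul ℝ ℝ] F := by
  funext x
  simp only [kernelPotential, convolution_def, ContinuousLinearMap.mul_apply', mul_comm]

/-- The derivatives of g of order at most k are uniformly continuous, and mollification commutes
with them. The bound on the radius later keeps the translated bump inside the annulus. -/
theorem exists_mollification_near {k : ℕ} {g : EuclideanSpace ℝ (Fin d) → ℝ}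
    (hg : ContDiff ℝ k g) (hg' : HasCompactSupport g) {R : ℝ} (hR : 0 < R) {η : ℝ} (hη : 0 < η) :
    ∃ φ : ContDiffBump (0 : EuclideanSpace ℝ (Fin d)), φ.rOut < R ∧
      ∀ α ∈ multiIndices d k, ∀ x,
        |multiDeriv α (kernelPotential g (φ.normed volume)) x - multiDeriv α g x| ≤ η := by
  have hev : ∀ᶠ δ in nhdsWithin (0 : ℝ) (Set.Ioi 0), ∀ α ∈ multiIndices d k, ∀ x,
      ∀ y ∈ ball x δ, dist (multiDeriv α g y) (multiDeriv α g x) ≤ η := by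
    refine (Filter.eventually_all_finset _).2 fun α hα => ?_
    obtain ⟨L, hL, hL'⟩ := exists_list_multiDeriv α
    have hLk : L.length ≤ k := hL ▸ mem_multiIndices.1 hα
    rw [hL']
    have hcd : ContDiff ℝ (L.length + 0 : ℕ) g := hg.of_le (by exact_mod_cast hLk)
    have huc := (hasCompactSupport_foldr_partialDeriv hg' L
      hcd).uniformContinuous_of_continuous (contDiff_foldr_partialDeriv L 0 hcd).continuous
    obtain ⟨δ, hδ, H⟩ := Metric.uniformContinuous_iff.1 huc η hη
    filter_upwards [Ioo_mem_nhdsGT hδ] with τ hτ x y hy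
    exact (H ((mem_ball.1 hy).trans hτ.2)).le
  obtain ⟨δ, ⟨hδ, hδ0⟩, hδR⟩ := ((hev.and self_mem_nhdsWithin).and (Ioo_mem_nhdsGT hR)).exists
  have hδ0' : (0 : ℝ) < δ := hδ0
  refine ⟨⟨δ / 2, δ, by positivity, by linarith⟩, hδR.2, fun α hα x => ?_⟩
  obtain ⟨L, hL, hL'⟩ := exists_list_multiDeriv α
  have hLk : L.length ≤ k := hL ▸ mem_multiIndices.1 hα
  have hcd : ContDiff ℝ (L.length + 0 : ℕ) g := hg.of_le (by exact_mod_cast hLk)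
  have H := hδ α hα x
  rw [hL'] at H ⊢
  rw [hL', kernelPotential_eq_convolution_swap, foldr_partialDeriv_convolution
    (ContDiffBump.continuous_normed _).locallyIntegrable hg' L hcd, ← Real.dist_eq]
  exact ContDiffBump.dist_normed_convolution_le
    (contDiff_foldr_partialDeriv L 0 hcd).continuous.aestronglyMeasurable H

/-! ### Regularity and C^k bounds for potentials -/

theorem memCk_of_eqOn {k : ℕ} {f g : EuclideanSpace ℝ (Fin d) → ℝ} (hf : ContDiff ℝ k f)
    (h : Set.EqOn g f (ball a r)) : MemCk k (ball a r) g := by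
  refine ⟨hf.contDiffOn.congr h, fun α hα B hB hB' => ?_⟩
  obtain ⟨L, hL, hL'⟩ := exists_list_multiDeriv α
  have hcont : Continuous (L.foldr partialDeriv f) :=
    (contDiff_foldr_partialDeriv L 0 (hf.of_le
      (by exact_mod_cast hL ▸ mem_multiIndices.1 hα))).continuous
  rw [hL']
  refine UniformContinuousOn.congr (((isCompact_closedBall a r).uniformContinuousOn_of_continuous
    hcont.continuousOn).mono (hB.trans ball_subset_closedBall)) fun x hx => ?_
  exact (foldr_partialDeriv_eqOn isOpen_ball h L (hB hx)).symm

theorem contDiff_kernelPotential {V : Set (EuclideanSpace ℝ (Fin d))} (k : ℕ)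
    {F h : EuclideanSpace ℝ (Fin d) → ℝ}
    (hF : LocallyIntegrable F volume) (hh : IsTestFunction V h) :
    ContDiff ℝ k (kernelPotential F h) := by
  rw [kernelPotential_eq_convolution]
  exact hh.2.1.contDiff_convolution_right (n := k) _ hF (hh.1.of_le (by exact_mod_cast le_top))

theorem locallyIntegrable_indicator_differenceAnnulus (hr : 0 < r)
    {F : EuclideanSpace ℝ (Fin d) → ℝ} (hF : ContinuousOn F {0}ᶜ) :
    LocallyIntegrable ((differenceAnnulus d r).indicator F) volume := by
  have hc : ContinuousOn F (differenceAnnulus d r) :=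
    hF.mono fun z hz => ne_zero_of_mem_differenceAnnulus hr hz
  exact ((hc.integrableOn_compact (isCompact_differenceAnnulus d r)).integrable_indicator
    (isCompact_differenceAnnulus d r).measurableSet).locallyIntegrable

theorem memCk_kernelPotential (k : ℕ) (hr : 0 < r) {F h : EuclideanSpace ℝ (Fin d) → ℝ}
    (hF : ContinuousOn F {0}ᶜ) (hh : IsTestFunction (sourceAnnulus a r) h) :
    MemCk k (ball a r) (kernelPotential F h) :=
  memCk_of_eqOn (contDiff_kernelPotential k
    (locallyIntegrable_indicator_differenceAnnulus hr hF) hh)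
    (kernelPotential_congr hh (Set.eqOn_indicator.symm))

/-- Truncate `F` to the difference annulus and put every derivative on `h`: no derivative of `F`
enters the bound. -/
theorem abs_multiDeriv_kernelPotential_le (hr : 0 < r) {F h : EuclideanSpace ℝ (Fin d) → ℝ}
    (hF : ContinuousOn F {0}ᶜ) {ζ : ℝ} (hζ : 0 ≤ ζ)
    (hFζ : ∀ z ∈ differenceAnnulus d r, |F z| ≤ ζ)
    (hh : IsTestFunction (sourceAnnulus a r) h) (α : Fin d → ℕ)
    {x : EuclideanSpace ℝ (Fin d)} (hx : x ∈ ball a r) :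
    |multiDeriv α (kernelPotential F h) x| ≤ ζ * ∫ y, |multiDeriv α h y| := by
  obtain ⟨L, -, hL⟩ := exists_list_multiDeriv α
  have hLh : ContDiff ℝ (L.length + 0 : ℕ) h := hh.1.of_le (by exact_mod_cast le_top)
  have hint : Integrable (L.foldr partialDeriv h) :=
    (contDiff_foldr_partialDeriv L 0 hLh).continuous.integrable_of_hasCompactSupport
      (hasCompactSupport_foldr_partialDeriv hh.2.1 L hLh)
  rw [hL, hL, foldr_partialDeriv_eqOn isOpen_ball
    (kernelPotential_congr hh (Set.eqOn_indicator (f := F)).symm) L hx,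
    kernelPotential_eq_convolution, foldr_partialDeriv_convolution
      (locallyIntegrable_indicator_differenceAnnulus hr hF) hh.2.1 L hLh,
    ← kernelPotential_eq_convolution, ← integral_const_mul, ← Real.norm_eq_abs]
  refine norm_integral_le_of_norm_le (hint.abs.const_mul ζ) (.of_forall fun y => ?_)
  rw [norm_mul, Real.norm_eq_abs, Real.norm_eq_abs]
  gcongr
  by_cases hz : x - y ∈ differenceAnnulus d r
  · rw [Set.indicator_of_mem hz]; exact hFζ _ hz
  · rw [Set.indicator_of_notMem hz]; simpa using hζ

/-! ### Moving the mollifier into the annulus, and the final estimate -/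

theorem kernelPotential_translate (F h : EuclideanSpace ℝ (Fin d) → ℝ)
    (b : EuclideanSpace ℝ (Fin d)) :
    kernelPotential (fun z => F (z + b)) (fun y => h (y - b)) = kernelPotential F h := by
  funext x
  rw [kernelPotential, kernelPotential,
    ← integral_sub_right_eq_self (fun y => F (x - y) * h y) b]
  congr 1
  funext y
  congr 2
  abel

/-- The centre lies midway between the radii 3r and 4r, leaving room r/2 on each side. -/
theorem isTestFunction_normed_translate
    {φ : ContDiffBump (0 : EuclideanSpace ℝ (Fin d))} (hφ : φ.rOut < r / 2)
    {b : EuclideanSpace ℝ (Fin d)} (hb : dist b a = 7 / 2 * r) :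
    IsTestFunction (sourceAnnulus a r) (fun y => φ.normed volume (y - b)) := by
  have hs : tsupport (fun y => φ.normed volume (y - b)) ⊆ closedBall b φ.rOut := by
    refine closure_minimal (fun y hy => ?_) isClosed_closedBall
    have h1 : y - b ∈ tsupport (φ.normed volume) := subset_tsupport _ hy
    rw [φ.tsupport_normed_eq] at h1
    simpa [dist_eq_norm] using h1
  refine ⟨(φ.contDiff_normed (n := ⊤)).comp (contDiff_id.sub contDiff_const),
    HasCompactSupport.of_support_subset_isCompact (isCompact_closedBall b φ.rOut)
      ((subset_tsupport _).trans hs), hs.trans fun y hy => ?_⟩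
  rw [mem_closedBall] at hy
  simp only [Set.mem_sdiff, mem_ball, mem_closedBall, not_le]
  have h1 := dist_triangle y b a
  have h2 := dist_triangle_left b a y
  constructor <;> linarith

theorem exists_potentialK_near {β : ℝ} (hd : 0 < d) (hβ : β < 0) (hβd : β + d < 2) {k : ℕ}
    (hr : 0 < r) {u : EuclideanSpace ℝ (Fin d) → ℝ} (hu : MemCk k (ball a r) u)
    {η : ℝ} (hη : 0 < η) :
    ∃ h, IsTestFunction (sourceAnnulus a r) h ∧ MemCk k (ball a r) (potentialK β h) ∧
      ∀ α ∈ multiIndices d k, ∀ x ∈ ball a r,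
        |multiDeriv α (fun x => u x - potentialK β h x) x| ≤ 3 * η := by
  obtain ⟨g, hg, hg', hgu⟩ := exists_compactlySupported_near hr hu hη
  obtain ⟨φ, hφ, hφg⟩ := exists_mollification_near hg hg' (half_pos hr) hη
  set b : EuclideanSpace ℝ (Fin d) := a + (7 / 2 * r) • EuclideanSpace.single ⟨0, hd⟩ 1 with hb
  have hba : dist b a = 7 / 2 * r := by
    rw [hb, dist_eq_norm, add_sub_cancel_left, norm_smul]
    simp [abs_of_pos hr]
  have hh := isTestFunction_normed_translate hφ hba
  rw [← kernelPotential_translate g _ b] at hφg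
  set h := fun y => φ.normed volume (y - b)
  set F := fun z => g (z + b) with hF
  have hFc : Continuous F := hg.continuous.comp (continuous_add_const b)
  have hI : ∀ α : Fin d → ℕ, 0 ≤ ∫ y, |multiDeriv α h y| :=
    fun α => integral_nonneg fun y => abs_nonneg _
  set I := ∑ α ∈ multiIndices d k, ∫ y, |multiDeriv α h y|
  have hI0 : 0 ≤ I := Finset.sum_nonneg fun α _ => hI α
  -- `h` is fixed before `G` is chosen, so the tolerance may depend on the L¹ norms of its
  -- derivatives; the 1 avoids division by zero.
  have hζ : 0 < η / (I + 1) := by positivity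
  obtain ⟨G, hG, hFG⟩ := exists_reproducedKernel_near a hr hβ hβd hFc hζ
  obtain ⟨f, hf, hGf⟩ := hG.2 h hh
  have hK : ContinuousOn (kernelK β : EuclideanSpace ℝ (Fin d) → ℝ) {0}ᶜ :=
    (contDiffOn_norm_rpow β).continuousOn
  have hfK : MemCk k (ball a r) (potentialK β f) := memCk_kernelPotential k hr hK hf
  have hFk := memCk_kernelPotential k hr hFc.continuousOn hh
  refine ⟨f, hf, hfK, fun α hα x hx => ?_⟩
  have hdiff : Set.EqOn (fun x => kernelPotential F h x - potentialK β f x)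
      (kernelPotential (fun z => F z - G z) h) (ball a r) := by
    intro y hy
    simp only
    rw [← hGf hy]
    simp only [kernelPotential, sub_mul]
    exact (integral_sub (integrable_kernel_mul hr hFc.continuousOn hh hy)
      (integrable_kernel_mul hr hG.1.continuousOn hh hy)).symm
  have h3 : |multiDeriv α (kernelPotential (fun z => F z - G z) h) x| ≤ η := by
    refine (abs_multiDeriv_kernelPotential_le hr (hFc.continuousOn.sub hG.1.continuousOn) hζ.le
      hFG hh α hx).trans ?_
    have hle : ∫ y, |multiDeriv α h y| ≤ I :=
      Finset.single_le_sum (f := fun α => ∫ y, |multiDeriv α h y|) (fun α _ => hI α) hα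
    rw [div_mul_eq_mul_div, div_le_iff₀ (by positivity)]
    gcongr
    linarith
  have h1 := hgu α hα x hx
  have h2 := hφg α hα x
  obtain ⟨L, hL, hL'⟩ := exists_list_multiDeriv α
  have hLk : L.length ≤ k := hL ▸ mem_multiIndices.1 hα
  rw [hL'] at h3
  rw [hL', hL'] at h1 h2
  rw [hL', foldr_partialDeriv_sub isOpen_ball hu.1 hfK.1 L hLk hx]
  rw [← foldr_partialDeriv_eqOn isOpen_ball hdiff L hx,
    foldr_partialDeriv_sub isOpen_ball hFk.1 hfK.1 L hLk hx] at h3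
  -- Three errors of size η: u to g, g to its mollification F * h, and F * h to G * h, the Riesz
  -- potential.
  simp only [abs_le] at h1 h2 h3 ⊢
  constructor <;> linarith [h1.1, h1.2, h2.1, h2.2, h3.1, h3.2]

end RieszApprox

theorem corollary2p2 (d : ℕ) (s : ℝ) (hs0 : 0 < s) (hs1 : s < 1) (hd : 2 * s < (d : ℝ))
    (k : ℕ) (a : EuclideanSpace ℝ (Fin d)) (r : ℝ) (hr : 0 < r)
    (u : EuclideanSpace ℝ (Fin d) → ℝ) (hu : RieszApprox.MemCk k (ball a r) u)
    (ε : ℝ) (hε : 0 < ε) :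
    ∃ h : EuclideanSpace ℝ (Fin d) → ℝ,
      RieszApprox.IsTestFunction (ball a (4 * r) \ closedBall a (3 * r)) h ∧
      RieszApprox.MemCk k (ball a r) (RieszApprox.potentialK (2 * s - d) h) ∧
      RieszApprox.ckNorm k (ball a r)
        (fun x => u x - RieszApprox.potentialK (2 * s - d) h x) < ENNReal.ofReal ε := by
  have hd0 : 0 < d := by
    have : (0 : ℝ) < d := by linarith
    exact_mod_cast this
  set N := (RieszApprox.multiIndices d k).card
  -- Each of the N multi-indices contributes at most 3η; N + 1 instead of N makes the total strictly
  -- less than ε.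
  have hη : 0 < ε / (3 * (N + 1)) := by positivity
  obtain ⟨h, hh, hK, H⟩ := RieszApprox.exists_potentialK_near (β := 2 * s - d) hd0
    (by linarith) (by linarith) hr hu hη
  refine ⟨h, hh, hK, ?_⟩
  calc RieszApprox.ckNorm k (ball a r)
        (fun x => u x - RieszApprox.potentialK (2 * s - d) h x)
      ≤ ∑ _α ∈ RieszApprox.multiIndices d k, ENNReal.ofReal (3 * (ε / (3 * (N + 1)))) := by
        refine Finset.sum_le_sum fun α hα => iSup₂_le fun x hx => ?_
        rw [Real.enorm_eq_ofReal_abs]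
        exact ENNReal.ofReal_le_ofReal (H α hα x hx)
    _ = ENNReal.ofReal (N * (3 * (ε / (3 * (N + 1))))) := by
        rw [Finset.sum_const, ENNReal.ofReal_mul (Nat.cast_nonneg N), ENNReal.ofReal_natCast,
          nsmul_eq_mul]
    _ < ENNReal.ofReal ε := by
        rw [ENNReal.ofReal_lt_ofReal_iff hε]
        have : (N : ℝ) * (3 * (ε / (3 * (N + 1)))) = ε * (N / (N + 1)) := by field_simp
        rw [this]
        refine mul_lt_of_lt_one_right hε ?_
        rw [div_lt_one (by positivity)]
        linarith
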